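/- Let $(X_n)_{n}$ be a non-empty countable (finite or countably infinite) family of Polish spaces, let $X=\prod_n X_n$ carry the product topology and its Borel $\sigma$-algebra, and let $\nu_n$ be a Borel probability measure on $X_n$ for each $n$. Write $\langle f,\mu\rangle=\int f\,d\mu$. For Borel functions $g_n:X_n\to[0,\infty)$ put $\oplus g(x)=\sum_n g_n(x_n)\in[0,+\infty]$, $x\in X$, and define: - $G(\nu)$: the set of all $\oplus g$, where the $g_n:X_n\to[0,\infty)$ are Borel with $\sum_n\langle g_n,\nu_n\rangle<+\infty$; - $B(\nu)$: the vector space of all Borel functions $f:X\to\mathbb R$ with $|f|\le\oplus g$ for some $\oplus g\in G(\nu)$; - $C_b$: the set of all bounded continuous functions $f:X\to\mathbb R$; - $U(\nu)$: the set of all upper semicontinuous functions $f:X\to\mathbb R$ such that $f^+$ is bounded and $f^-\in B(\nu)$; - $\mathcal P(\nu)$: the set of all Borel probability measures $\mu$ on $X$ whose $n$-th marginal is $\nu_n$ for every $n$. Then $C_b\subseteq U(\nu)\subseteq B(\nu)$, and every $f\in B(\nu)$ is integrable under every $\mu\in\mathcal P(\nu)$. Let $\phi:B(\nu)\to\mathbb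 R$ be convex and increasing ($f\ge f'$ pointwise implies $\phi(f)\ge\phi(f')$), and assume that $$\phi(f)\le m+\sum_n\langle g_n,\nu_n\rangle$$ whenever $f\in B(\nu)$, $m\in\mathbb R$ and $\oplus g\in G(\nu)$ (with $\sum_n\langle g_n,\nu_n\rangle<+\infty$) satisfy $f\le m+\oplus g$ pointwise. For $S\in\{C_b,U(\nu)\}$ and $\mu\in\mathcal P(\nu)$ let $$\phi^*_S(\mu)=\sup_{f\in S}\big(\langle f,\mu\rangle-\phi(f)\big)\in\mathbb R\cup\{+\infty\},$$ and assume that $\phi^*_{C_b}(\mu)=\phi^*_{U(\nu)}(\mu)$ for all $\mu\in\mathcal P(\nu)$. Then $$\phi(f)=\max_{\mu\in\mathcal P(\nu)}\big(\langle f,\mu\rangle-\phi^*_{C_b}(\mu)\big)$$ (the supremum is attained) for all $f\in B(\nu)\cap(U(\nu)+G(\nu))$, that is, for all $f\in B(\nu)$ of the form $f=h+\oplus g$ with $h\in U(\nu)$ and $\oplus g\in G(\nu)$. -/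

import Mathlib

open MeasureTheory
open scoped ENNReal NNReal

noncomputable section

namespace MarginalDuality

/-- `⊕g = ∑ₙ gₙ ∘ πₙ`, a function on the product with values in `[0, ∞]`. -/
def oplus {ι : Type*} {X : ι → Type*} (g : ∀ n, X n → ℝ≥0) (x : ∀ n, X n) : ℝ≥0∞ :=
  ∑' n, (g n (x n) : ℝ≥0∞)

/-- `∑ₙ ⟨gₙ, νₙ⟩`, with value in `[0, ∞]`. -/
def price {ι : Type*} {X : ι → Type*} [∀ n, MeasurableSpace (X n)]
    (ν : ∀ n, Measure (X n)) (g : ∀ n, X n → ℝ≥0) : ℝ≥0∞ :=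
  ∑' n, ∫⁻ y, (g n y : ℝ≥0∞) ∂(ν n)

/-- The families `g ∈ ∏ₙ Bₙ⁺` of Borel functions `gₙ : Xₙ → [0, ∞)` with `∑ₙ ⟨gₙ, νₙ⟩ < ∞`. -/
def IsAdmissible {ι : Type*} {X : ι → Type*} [∀ n, MeasurableSpace (X n)]
    (ν : ∀ n, Measure (X n)) (g : ∀ n, X n → ℝ≥0) : Prop :=
  (∀ n, Measurable (g n)) ∧ price ν g < ∞

/-- `G(ν)`, the set of all `⊕g` with `g` admissible. -/
def GSet {ι : Type*} {X : ι → Type*} [∀ n, MeasurableSpace (X n)]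
    (ν : ∀ n, Measure (X n)) : Set ((∀ n, X n) → ℝ≥0∞) :=
  {G | ∃ g, IsAdmissible ν g ∧ G = oplus g}

lemma IsAdmissible.add {ι : Type*} {X : ι → Type*} [∀ n, MeasurableSpace (X n)]
    {ν : ∀ n, Measure (X n)} {g g' : ∀ n, X n → ℝ≥0}
    (h : IsAdmissible ν g) (h' : IsAdmissible ν g') : IsAdmissible ν (g + g') := by
  refine ⟨fun n => (h.1 n).add (h'.1 n), ?_⟩
  have : price ν (g + g') = price ν g + price ν g' := by
    unfold price
    rw [← ENNReal.tsum_add]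
    refine tsum_congr fun n => ?_
    rw [← lintegral_add_left (by have := h.1 n; fun_prop)]
    simp
  rw [this]
  exact ENNReal.add_lt_top.2 ⟨h.2, h'.2⟩

lemma IsAdmissible.smul {ι : Type*} {X : ι → Type*} [∀ n, MeasurableSpace (X n)]
    {ν : ∀ n, Measure (X n)} {g : ∀ n, X n → ℝ≥0} (c : ℝ≥0)
    (h : IsAdmissible ν g) : IsAdmissible ν (fun n y => c * g n y) := by
  refine ⟨fun n => (h.1 n).const_mul c, ?_⟩
  have : price ν (fun n y => c * g n y) = c * price ν g := by
    unfold price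
    rw [← ENNReal.tsum_mul_left]
    refine tsum_congr fun n => ?_
    rw [← lintegral_const_mul _ (by have := h.1 n; fun_prop)]
    simp
  rw [this]
  exact ENNReal.mul_lt_top ENNReal.coe_lt_top h.2

/-- `B(ν)`: the vector space of all Borel functions `f : X → ℝ` on the product `X` such that
`|f| ≤ ⊕g` for some `⊕g ∈ G(ν)`. -/
def BSpace {ι : Type*} {X : ι → Type*} [∀ n, MeasurableSpace (X n)]
    (ν : ∀ n, Measure (X n)) : Submodule ℝ ((∀ n, X n) → ℝ) where
  carrier := {f | Measurable f ∧ ∃ G ∈ GSet ν, ∀ x, ENNReal.ofReal |f x| ≤ G x}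
  zero_mem' := ⟨measurable_const, oplus 0,
    ⟨0, ⟨fun _ => measurable_const, by simp [price]⟩, rfl⟩, by simp⟩
  add_mem' := by
    rintro f f' ⟨hf, _, ⟨g, hg, rfl⟩, hfg⟩ ⟨hf', _, ⟨g', hg', rfl⟩, hfg'⟩
    refine ⟨hf.add hf', _, ⟨g + g', hg.add hg', rfl⟩, fun x => ?_⟩
    have : oplus (g + g') x = oplus g x + oplus g' x := by
      simp [oplus, ← ENNReal.tsum_add]
    rw [this]
    calc ENNReal.ofReal |f x + f' x| ≤ ENNReal.ofReal (|f x| + |f' x|) :=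
          ENNReal.ofReal_le_ofReal (abs_add_le _ _)
      _ ≤ ENNReal.ofReal |f x| + ENNReal.ofReal |f' x| := ENNReal.ofReal_add_le
      _ ≤ _ := add_le_add (hfg x) (hfg' x)
  smul_mem' := by
    rintro c f ⟨hf, _, ⟨g, hg, rfl⟩, hfg⟩
    refine ⟨hf.const_smul c, _, ⟨_, hg.smul ‖c‖₊, rfl⟩, fun x => ?_⟩
    have h1 : oplus (fun n y => ‖c‖₊ * g n y) x = ‖c‖₊ * oplus g x := by
      simp [oplus, ← ENNReal.tsum_mul_left]
    have h2 : ENNReal.ofReal |(c • f) x| = ‖c‖₊ * ENNReal.ofReal |f x| := by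
      rw [Pi.smul_apply, smul_eq_mul, abs_mul, ENNReal.ofReal_mul (abs_nonneg c),
        ← Real.norm_eq_abs c, ofReal_norm, enorm_eq_nnnorm]
    rw [h1, h2]
    gcongr
    exact hfg x

/-- `C_b`: bounded continuous functions on the product. -/
def CbSet {ι : Type*} (X : ι → Type*) [∀ n, TopologicalSpace (X n)] : Set ((∀ n, X n) → ℝ) :=
  {f | Continuous f ∧ ∃ C : ℝ, ∀ x, |f x| ≤ C}

/-- `B_b`: bounded Borel functions on the product. -/
def BbSet {ι : Type*} (X : ι → Type*) [∀ n, MeasurableSpace (X n)] : Set ((∀ n, X n) → ℝ) :=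
  {f | Measurable f ∧ ∃ C : ℝ, ∀ x, |f x| ≤ C}

/-- `U(ν)`: upper semicontinuous functions `f` with `f⁺ ∈ B_b` and `f⁻ ∈ B(ν)`. -/
def USet {ι : Type*} {X : ι → Type*} [∀ n, TopologicalSpace (X n)]
    [∀ n, MeasurableSpace (X n)] (ν : ∀ n, Measure (X n)) : Set ((∀ n, X n) → ℝ) :=
  {f | UpperSemicontinuous f ∧ (fun x => max (f x) 0) ∈ BbSet X ∧
    (fun x => max (-f x) 0) ∈ BSpace ν}

/-- `P(ν)`: probability measures on the product with marginals `νₙ`. -/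
def Couplings {ι : Type*} {X : ι → Type*} [∀ n, MeasurableSpace (X n)]
    (ν : ∀ n, Measure (X n)) : Set (Measure (∀ n, X n)) :=
  {μ | IsProbabilityMeasure μ ∧ ∀ n, μ.map (fun x => x n) = ν n}

/-- The conjugate `φ*_S(μ) = sup_{f ∈ S} (⟨f, μ⟩ - φ(f))` for `S ⊆ B(ν)`,
with values in `[-∞, ∞]`. -/
def conj {ι : Type*} {X : ι → Type*} [∀ n, MeasurableSpace (X n)]
    {ν : ∀ n, Measure (X n)} (φ : BSpace ν → ℝ) (S : Set ((∀ n, X n) → ℝ))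
    (μ : Measure (∀ n, X n)) : EReal :=
  ⨆ (f : BSpace ν) (_ : (f : (∀ n, X n) → ℝ) ∈ S),
    (((∫ x, (f : (∀ n, X n) → ℝ) x ∂μ) - φ f : ℝ) : EReal)

/-- `B_b ⊆ B(ν)`. -/
lemma bbSet_subset_bSpace {ι : Type*} [Nonempty ι] {X : ι → Type*} [∀ n, MeasurableSpace (X n)]
    (ν : ∀ n, Measure (X n)) [∀ n, IsProbabilityMeasure (ν n)] :
    BbSet X ⊆ (BSpace ν : Set ((∀ n, X n) → ℝ)) := by
  classical
  rintro f ⟨hf, C, hC⟩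
  obtain ⟨n₀⟩ := ‹Nonempty ι›
  refine ⟨hf, _, ⟨fun n _ => if n = n₀ then C.toNNReal else 0,
    ⟨fun n => measurable_const, ?_⟩, rfl⟩, fun x => ?_⟩
  · simp only [price, lintegral_const, measure_univ, mul_one]
    rw [tsum_eq_single n₀ (by intro n hn; simp [hn])]
    simp
  · simp only [oplus]
    rw [tsum_eq_single n₀ (by intro n hn; simp [hn])]
    rw [if_pos rfl]
    exact ENNReal.ofReal_le_ofReal (hC x)

/-- `C_b ⊆ B(ν)`, so that `conj φ (CbSet X)` is the supremum over all of `C_b`. -/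
lemma cbSet_subset_bSpace {ι : Type*} [Countable ι] [Nonempty ι] {X : ι → Type*}
    [∀ n, TopologicalSpace (X n)] [∀ n, PolishSpace (X n)] [∀ n, MeasurableSpace (X n)]
    [∀ n, BorelSpace (X n)] (ν : ∀ n, Measure (X n)) [∀ n, IsProbabilityMeasure (ν n)] :
    CbSet X ⊆ (BSpace ν : Set ((∀ n, X n) → ℝ)) :=
  fun _ hf => bbSet_subset_bSpace ν ⟨hf.1.measurable, hf.2⟩

/-- `U(ν) ⊆ B(ν)`, so that `conj φ (USet ν)` is the supremum over all of `U(ν)`. -/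
lemma uSet_subset_bSpace {ι : Type*} [Nonempty ι] {X : ι → Type*}
    [∀ n, TopologicalSpace (X n)] [∀ n, MeasurableSpace (X n)]
    (ν : ∀ n, Measure (X n)) [∀ n, IsProbabilityMeasure (ν n)] :
    USet ν ⊆ (BSpace ν : Set ((∀ n, X n) → ℝ)) := by
  rintro f ⟨-, h1, h2⟩
  have h3 := (BSpace ν).sub_mem (bbSet_subset_bSpace ν h1) h2
  suffices h : f = (fun x => max (f x) 0) - fun x => max (-f x) 0 by
    rw [h]
    exact h3
  ext x
  simp only [Pi.sub_apply]
  rcases le_total 0 (f x) with h | h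
  · simp [h]
  · simp [h]

/-- Functions in `B(ν)` are integrable under every `μ ∈ P(ν)`, so that `⟨f, μ⟩` makes sense. -/
lemma integrable_of_mem {ι : Type*} [Countable ι] {X : ι → Type*} [∀ n, MeasurableSpace (X n)]
    {ν : ∀ n, Measure (X n)} {f : (∀ n, X n) → ℝ} (hf : f ∈ BSpace ν)
    {μ : Measure (∀ n, X n)} (hμ : μ ∈ Couplings ν) : Integrable f μ := by
  obtain ⟨hm, _, ⟨g, hg, rfl⟩, hfg⟩ := hf
  refine ⟨hm.aestronglyMeasurable, ?_⟩
  rw [hasFiniteIntegral_iff_norm]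
  refine lt_of_le_of_lt (lintegral_mono hfg) (lt_of_eq_of_lt ?_ hg.2)
  unfold oplus price
  rw [lintegral_tsum]
  · refine tsum_congr fun n => ?_
    have := hg.1 n
    rw [← hμ.2 n, lintegral_map (by fun_prop) (measurable_pi_apply n)]
  · intro n
    have h1 := hg.1 n
    exact (h1.comp (measurable_pi_apply n)).coe_nnreal_ennreal.aemeasurable

end MarginalDuality

end

open Filter Topology

namespace MarginalDuality

/-! Attainment: a finite convex φ has an algebraic subgradient ℓ at `f` (`exists_subgradient`), and
scaling turns the bound on φ into the same bound on ℓ (`isDominated_of_subgradient`). Domination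
makes ℓ positive, normalized and tight on C_b, so there it is integration against a measure μ, whose
marginals domination also forces to be ν (`exists_coupling`). Off C_b only ℓ ≤ ⟨·, μ⟩ is needed: on
U(ν) by approximation with continuous functions from above (`le_integral_of_mem_uSet`), on G(ν) by
domination, since ⟨⊕g, μ⟩ is the price of g. With ℓ f ≤ ⟨f, μ⟩ the subgradient inequality gives
φ*(μ) ≤ ⟨f, μ⟩ - φ(f).

Weak duality is not automatic, as `f` need not lie in C_b. It is approximated in μ-mean by elements
of U(ν) below it (`exists_uSet_le`); monotonicity of φ and equality of the two conjugates then
conclude. -/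

/-- A finite convex function on a real vector space has an algebraic subgradient at every point. -/
lemma exists_subgradient {E : Type*} [AddCommGroup E] [Module ℝ E] {φ : E → ℝ}
    (hφ : ConvexOn ℝ Set.univ φ) (x₀ : E) :
    ∃ ℓ : E →ₗ[ℝ] ℝ, ∀ k, ℓ k ≤ φ (x₀ + k) - φ x₀ := by
  -- The conic hull of the epigraph of k ↦ φ (x₀ + k) - φ x₀.
  let s : PointedCone ℝ (E × ℝ) :=
    { carrier := {p | ∃ c : ℝ, 0 < c ∧ φ (x₀ + c • p.1) - φ x₀ ≤ c * p.2}
      zero_mem' := ⟨1, one_pos, by simp⟩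
      add_mem' := by
        rintro ⟨p, r⟩ ⟨q, t⟩ ⟨c, hc, h⟩ ⟨d, hd, h'⟩
        have hcd : 0 < c + d := add_pos hc hd
        -- The weights d/(c+d) and c/(c+d) bring both scales to the common value cd/(c+d).
        refine ⟨c * d / (c + d), by positivity, ?_⟩
        have key := hφ.2 (Set.mem_univ (x₀ + c • p)) (Set.mem_univ (x₀ + d • q))
          (by positivity : 0 ≤ d / (c + d)) (by positivity : 0 ≤ c / (c + d))
          (by field_simp; ring)
        have e : (d / (c + d)) • (x₀ + c • p) + (c / (c + d)) • (x₀ + d • q) =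
            x₀ + (c * d / (c + d)) • (p + q) := by
          have h1 : x₀ = (d / (c + d)) • x₀ + (c / (c + d)) • x₀ := by
            rw [← add_smul, show d / (c + d) + c / (c + d) = 1 by field_simp; ring, one_smul]
          conv_rhs => rw [h1]
          simp only [smul_add, smul_smul]
          rw [show d / (c + d) * c = c * d / (c + d) by ring,
            show c / (c + d) * d = c * d / (c + d) by ring]
          abel
        rw [e] at key
        simp only [smul_eq_mul] at key
        simp only [Prod.mk_add_mk] at h h' ⊢
        have h2 : d / (c + d) * (φ (x₀ + c • p) - φ x₀) ≤ d / (c + d) * (c * r) := by gcongr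
        have h3 : c / (c + d) * (φ (x₀ + d • q) - φ x₀) ≤ c / (c + d) * (d * t) := by gcongr
        have h4 : φ x₀ = d / (c + d) * φ x₀ + c / (c + d) * φ x₀ := by field_simp; ring
        have h5 : c * d / (c + d) * (r + t) =
          d / (c + d) * (c * r) + c / (c + d) * (d * t) := by ring
        rw [h5]
        linarith
      smul_mem' := by
        rintro ⟨a, ha⟩ ⟨p, r⟩ ⟨c, hc, h⟩
        rcases ha.eq_or_lt with rfl | ha'
        · exact ⟨1, one_pos, by simp [Nonneg.mk_smul]⟩
        · refine ⟨c / a, by positivity, ?_⟩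
          simp only [Nonneg.mk_smul, Prod.smul_mk, smul_smul, smul_eq_mul] at h ⊢
          rwa [div_mul_cancel₀ _ ha'.ne', ← mul_assoc, div_mul_cancel₀ _ ha'.ne'] }
  -- The height on the vertical axis is nonnegative on the cone, and every vector can be moved
  -- vertically into the cone: M. Riesz extension applies, and minus the extension on E is the
  -- subgradient.
  let F : (E × ℝ) →ₗ.[ℝ] ℝ :=
    { domain := (⊥ : Submodule ℝ E).prod ⊤
      toFun := (LinearMap.snd ℝ E ℝ).domRestrict _ }
  obtain ⟨g, hg, hgs⟩ := riesz_extension s F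
    (by
      rintro ⟨⟨p, r⟩, hp, hr⟩ ⟨c, hc, h⟩
      obtain rfl : p = 0 := by simpa using hp
      have : 0 ≤ c * r := by simpa using h
      exact nonneg_of_mul_nonneg_right this hc)
    (by
      rintro ⟨p, r⟩
      refine ⟨⟨(0, φ (x₀ + p) - φ x₀ - r), by simp, trivial⟩, 1, one_pos, ?_⟩
      simp)
  refine ⟨-(g ∘ₗ LinearMap.inl ℝ E ℝ), fun k => ?_⟩
  have h1 := hgs (k, φ (x₀ + k) - φ x₀) ⟨1, one_pos, by simp⟩
  have h2 : g (0, φ (x₀ + k) - φ x₀) = φ (x₀ + k) - φ x₀ :=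
    hg ⟨(0, φ (x₀ + k) - φ x₀), by simp, trivial⟩
  have h3 : (k, φ (x₀ + k) - φ x₀) = (k, (0 : ℝ)) + ((0 : E), φ (x₀ + k) - φ x₀) := by simp
  rw [h3, map_add, h2] at h1
  simp only [LinearMap.neg_apply, LinearMap.comp_apply, LinearMap.inl_apply]
  linarith

/-! ### Semicontinuous approximation -/

/-- A real upper semicontinuous function which is bounded above is the pointwise limit of bounded
continuous functions from above. -/
lemma exists_continuous_tendsto_of_upperSemicontinuous {E : Type*} [TopologicalSpace E]
    [TopologicalSpace.PseudoMetrizableSpace E] {h : E → ℝ} (hh : UpperSemicontinuous h) {C : ℝ}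
    (hC : ∀ x, h x ≤ C) :
    ∃ k : ℕ → E → ℝ, (∀ j, Continuous (k j)) ∧ (∀ (j : ℕ) x, -(j : ℝ) ≤ k j x) ∧
      (∀ j x, h x ≤ k j x) ∧ (∀ j x, k j x ≤ max C 0) ∧
      ∀ x, Tendsto (fun j => k j x) atTop (𝓝 (h x)) := by
  let := TopologicalSpace.pseudoMetrizableSpacePseudoMetric E
  -- The approximants are sup-convolutions with slope `j`; truncating at `-j` keeps them bounded
  -- below.
  let v : ℕ → E → E → ℝ := fun j x y => max (h y) (-j) - j * dist x y
  have hle : ∀ j x y, v j x y ≤ max C 0 := fun j x y => by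
    have h1 : max (h y) (-(j : ℝ)) ≤ max C 0 :=
      max_le_max (hC y) (neg_nonpos.2 j.cast_nonneg)
    have h2 : 0 ≤ (j : ℝ) * dist x y := by positivity
    simp only [v]; linarith
  have hbdd : ∀ j x, BddAbove (Set.range (v j x)) := fun j x =>
    ⟨_, by rintro _ ⟨y, rfl⟩; exact hle j x y⟩
  have hself : ∀ (j : ℕ) x, max (h x) (-(j : ℝ)) ≤ ⨆ y, v j x y := fun j x =>
    (by simp [v] : max (h x) (-(j : ℝ)) = v j x x).le.trans (le_ciSup (hbdd j x) x)
  refine ⟨fun j x => ⨆ y, v j x y, fun j => ?_, fun j x => (le_max_right _ _).trans (hself j x),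
    fun j x => (le_max_left _ _).trans (hself j x), fun j x => ?_, fun x => ?_⟩
  · refine (LipschitzWith.of_le_add_mul (j : ℝ≥0) fun x y => ?_).continuous
    have : Nonempty E := ⟨x⟩
    refine ciSup_le fun z => ?_
    have h1 := le_ciSup (hbdd j y) z
    have h2 : (j : ℝ) * dist y z ≤ j * (dist x y + dist x z) := by
      gcongr
      exact dist_triangle_left y z x
    simp only [NNReal.coe_natCast]
    simp only [v] at h1 ⊢
    linarith
  · have : Nonempty E := ⟨x⟩
    exact ciSup_le (hle j x)
  · have : Nonempty E := ⟨x⟩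
    refine tendsto_order.2 ⟨fun a ha => Eventually.of_forall fun j =>
      ha.trans_le ((le_max_left _ _).trans (hself j x)), fun a ha => ?_⟩
    obtain ⟨b, hb, hba⟩ := exists_between ha
    obtain ⟨δ, hδ, hball⟩ := Metric.eventually_nhds_iff.1 (hh x b hb)
    -- Beyond `N`, the truncation level lies below `b`, and outside the δ-ball the penalty `j * δ`
    -- outweighs the bound on `h`.
    obtain ⟨N, hN⟩ := exists_nat_gt (max (-b) ((max C 0 - b) / δ))
    filter_upwards [eventually_ge_atTop N] with j hj
    have hNj : (N : ℝ) ≤ j := by exact_mod_cast hj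
    refine lt_of_le_of_lt (ciSup_le fun y => ?_) hba
    rcases lt_or_ge (dist x y) δ with hd | hd
    · have h1 : h y < b := hball (by rwa [dist_comm])
      have h2 : max (h y) (-(j : ℝ)) ≤ b :=
        max_le h1.le (by have := (le_max_left _ _).trans hN.le; linarith)
      have h3 : 0 ≤ (j : ℝ) * dist x y := by positivity
      simp only [v]; linarith
    · have h1 : (max C 0 - b) / δ ≤ j := ((le_max_right _ _).trans hN.le).trans hNj
      rw [div_le_iff₀ hδ] at h1
      have h2 : (j : ℝ) * δ ≤ j * dist x y := by gcongr
      have h3 : max (h y) (-(j : ℝ)) ≤ max C 0 :=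
        max_le_max (hC y) (neg_nonpos.2 j.cast_nonneg)
      simp only [v]; linarith

/-- Nonnegative functions with finite integral are approximated from below by bounded upper
semicontinuous functions. -/
lemma exists_bounded_upperSemicontinuous_le {α : Type*} [TopologicalSpace α] [MeasurableSpace α]
    [BorelSpace α] (μ : Measure α) [μ.WeaklyRegular] {g : α → ℝ≥0} (hg : Measurable g)
    (hfin : ∫⁻ x, g x ∂μ ≠ ∞) {ε : ℝ≥0∞} (hε : ε ≠ 0) :
    ∃ (u : α → ℝ≥0) (N : ℕ), (∀ x, u x ≤ g x) ∧ (∀ x, u x ≤ N) ∧ UpperSemicontinuous u ∧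
      ∫⁻ x, g x ∂μ ≤ ∫⁻ x, u x ∂μ + ε := by
  have hmono : ∀ x, Monotone fun N : ℕ => ((min (g x) N : ℝ≥0) : ℝ≥0∞) := fun x N M h => by
    have : (N : ℝ≥0) ≤ M := by exact_mod_cast h
    exact ENNReal.coe_le_coe.2 (min_le_min_left _ this)
  have hlim : Tendsto (fun N : ℕ => ∫⁻ x, ((min (g x) N : ℝ≥0) : ℝ≥0∞) ∂μ) atTop
      (𝓝 (∫⁻ x, g x ∂μ)) := by
    refine lintegral_tendsto_of_tendsto_of_monotone (fun N => by fun_prop)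
      (Eventually.of_forall hmono) (Eventually.of_forall fun x => ?_)
    obtain ⟨N, hN⟩ := exists_nat_ge (g x)
    refine tendsto_const_nhds.congr' ?_
    filter_upwards [eventually_ge_atTop N] with M hM
    rw [min_eq_left (hN.trans (by exact_mod_cast hM))]
  have h2 := (hlim.add_const (ε / 2)).eventually
    (eventually_gt_nhds (ENNReal.lt_add_right hfin (ENNReal.half_pos hε).ne'))
  obtain ⟨N, hN⟩ := h2.exists
  obtain ⟨u, hu, hus, hui⟩ := exists_upperSemicontinuous_le_lintegral_le (μ := μ)
    (fun x => min (g x) N)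
    (ne_top_of_le_ne_top hfin (lintegral_mono fun x => ENNReal.coe_le_coe.2 (min_le_left _ _)))
    (ENNReal.half_pos hε).ne'
  refine ⟨u, N, fun x => (hu x).trans (min_le_left _ _), fun x => (hu x).trans (min_le_right _ _),
    hus, hN.le.trans ?_⟩
  calc _ ≤ (∫⁻ x, u x ∂μ + ε / 2) + ε / 2 := by gcongr
    _ = _ := by rw [add_assoc, ENNReal.add_halves]

/-! ### Riesz representation via the Stone–Čech compactification -/

open BoundedContinuousFunction CompactlySupported in
/-- **Riesz representation** for tight functionals: a normalized positive linear functional on the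
bounded continuous functions of a completely regular space is integration against a probability
measure as soon as it is tight. -/
lemma exists_measure_of_tight {E : Type*} [TopologicalSpace E] [T35Space E] [MeasurableSpace E]
    [BorelSpace E] (Λ : (E →ᵇ ℝ) →ₗ[ℝ] ℝ) (hpos : ∀ f : E →ᵇ ℝ, (∀ x, 0 ≤ f x) → 0 ≤ Λ f)
    (hone : Λ (const E 1) = 1)
    (htight : ∀ ε : ℝ, 0 < ε → ∃ K : Set E, IsCompact K ∧ ∀ f : E →ᵇ ℝ,
      (∀ x, f x ≤ 1) → (∀ x ∈ K, f x ≤ 0) → Λ f ≤ ε) :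
    ∃ μ : Measure E, IsProbabilityMeasure μ ∧ ∀ f : E →ᵇ ℝ, ∫ x, f x ∂μ = Λ f := by
  let : MeasurableSpace (StoneCech E) := borel _
  have : BorelSpace (StoneCech E) := ⟨rfl⟩
  let i : E → StoneCech E := stoneCechUnit
  have hi : IsEmbedding i := isEmbedding_stoneCechUnit
  let res : C(StoneCech E, ℝ) → (E →ᵇ ℝ) := fun F => (mkOfCompact F).compContinuous ⟨i, hi.continuous⟩
  have hres : ∀ F x, res F x = F (i x) := fun F x => rfl
  let Λ' : C_c(StoneCech E, ℝ) →ₚ[ℝ] ℝ :=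
    { toFun g := Λ (res g)
      map_add' g g' := by rw [← map_add]; rfl
      map_smul' c g := by rw [RingHom.id_apply, ← map_smul]; rfl
      monotone' g g' h := by
        have := hpos (res g' - res g) fun x => sub_nonneg.2 (h (i x))
        rw [map_sub] at this
        exact sub_nonneg.1 this }
  let m := RealRMK.rieszMeasure Λ'
  have hm : ∀ F : C(StoneCech E, ℝ), ∫ y, F y ∂m = Λ (res F) := fun F =>
    RealRMK.integral_rieszMeasure Λ' ⟨F, HasCompactSupport.of_compactSpace _⟩
  have : m.Regular := inferInstanceAs (RealRMK.rieszMeasure Λ').Regular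
  have huniv : m Set.univ = 1 := by
    have h1 := hm 1
    have h2 : res 1 = const E 1 := rfl
    rw [h2, hone] at h1
    simp only [ContinuousMap.one_apply, integral_const, smul_eq_mul, mul_one] at h1
    rw [Measure.real, ENNReal.toReal_eq_one_iff] at h1
    exact h1
  have : IsProbabilityMeasure m := ⟨huniv⟩
  have hK : ∀ ε : ℝ, 0 < ε → ∃ K : Set E, IsCompact K ∧ ENNReal.ofReal (1 - ε) ≤ m (i '' K) := by
    intro ε hε
    obtain ⟨K, hKc, hKε⟩ := htight ε hε
    refine ⟨K, hKc, ?_⟩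
    have hiK : IsCompact (i '' K) := hKc.image hi.continuous
    -- By outer regularity it suffices to bound open U ⊇ i(K). A Urysohn function `F` for this pair
    -- gives the test function 1 - F∘i, at most 1 and zero on K.
    rw [Set.measure_eq_iInf_isOpen]
    refine le_iInf fun U => le_iInf fun hKU => le_iInf fun hU => ?_
    obtain ⟨F, hF1, -, hFs, hF01⟩ := exists_continuousMap_one_of_isCompact_subset_isOpen hiK hU hKU
    have h1 : 1 - ε ≤ Λ (res F) := by
      have := hKε (const E 1 - res F) (fun x => ?_) (fun x hx => ?_)
      · rw [map_sub, hone] at this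
        linarith
      · simpa [hres] using (hF01 (i x)).1
      · simp [hres, hF1 (Set.mem_image_of_mem i hx)]
    exact (ENNReal.ofReal_le_ofReal h1).trans (RealRMK.le_rieszMeasure_tsupport_subset Λ'
      (f := ⟨F, HasCompactSupport.of_compactSpace _⟩) hF01 hFs)
  have hrange : m (Set.range i)ᶜ = 0 := by
    refine le_antisymm (ENNReal.le_of_forall_pos_le_add fun ε hε _ => ?_) zero_le
    obtain ⟨K, hKc, hKm⟩ := hK ε hε
    have hiK : IsCompact (i '' K) := hKc.image hi.continuous
    refine (measure_mono (Set.compl_subset_compl.2 (Set.image_subset_range i K))).trans ?_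
    rw [measure_compl hiK.measurableSet (measure_ne_top _ _), huniv, zero_add,
      tsub_le_iff_left]
    refine le_trans ?_ (add_le_add_left hKm _)
    rw [← ENNReal.ofReal_coe_nnreal]
    refine le_trans ?_ ENNReal.ofReal_add_le
    simp
  -- E need not be Borel in its compactification; a complement of outer measure zero is enough to
  -- pull `m` back.
  have hnull : NullMeasurableSet (Set.range i) m :=
    (NullMeasurableSet.of_null hrange).of_compl
  have hborel : ∀ s : Set E, MeasurableSet s → ∃ t, MeasurableSet t ∧ i ⁻¹' t = s := by
    intro s hs
    rw [BorelSpace.measurable_eq (α := E), hi.eq_induced, borel_comap] at hs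
    exact hs
  have himage : ∀ t, i '' (i ⁻¹' t) = t ∩ Set.range i := fun t => Set.image_preimage_eq_inter_range
  have hmap : (m.comap i).map i = m := by
    ext t ht
    have hpre : MeasurableSet (i ⁻¹' t) := hi.continuous.measurable ht
    rw [Measure.map_apply hi.continuous.measurable ht,
      Measure.comap_apply₀ i m hi.injective _ hpre.nullMeasurableSet, himage]
    · exact measure_inter_conull hrange
    · intro s hs
      obtain ⟨t, ht, rfl⟩ := hborel s hs
      rw [himage]
      exact ht.nullMeasurableSet.inter hnull
  refine ⟨m.comap i, ⟨?_⟩, fun f => ?_⟩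
  · rw [← Set.preimage_univ (f := i), ← Measure.map_apply hi.continuous.measurable .univ, hmap,
      huniv]
  -- Boundedness puts the values of `f` in a compact interval, so `f` extends to the
  -- compactification.
  · have hg : Continuous fun x => (⟨f x, abs_le.1 (f.norm_coe_le_norm x)⟩ :
        Set.Icc (-‖f‖) ‖f‖) := f.continuous.subtype_mk _
    let F : C(StoneCech E, ℝ) :=
      ⟨fun y => (stoneCechExtend hg y : Set.Icc (-‖f‖) ‖f‖), continuous_subtype_val.comp (continuous_stoneCechExtend hg)⟩
    have hF : ∀ x, F (i x) = f x := fun x => by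
      simp [F, i]
    have hFres : res F = f := by ext x; exact hF x
    have h1 := hm F
    rw [← hmap, integral_map hi.continuous.aemeasurable
      F.continuous.aestronglyMeasurable, hFres] at h1
    rw [← h1]
    simp [hF]

/-! ### Algebra of ⊕g -/

section Oplus

variable {ι : Type*} {X : ι → Type*}

lemma oplus_add (g g' : ∀ n, X n → ℝ≥0) (x : ∀ n, X n) :
    oplus (g + g') x = oplus g x + oplus g' x := by
  simp [oplus, ← ENNReal.tsum_add]

lemma oplus_smul (c : ℝ≥0) (g : ∀ n, X n → ℝ≥0) (x : ∀ n, X n) :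
    oplus (fun n y => c * g n y) x = c * oplus g x := by
  simp [oplus, ← ENNReal.tsum_mul_left]

/-- The family concentrated on the coordinate `n`, equal to `g` there. -/
def single [DecidableEq ι] (n : ι) (g : X n → ℝ≥0) : ∀ k, X k → ℝ≥0 :=
  Pi.single (M := fun k => X k → ℝ≥0) n g

lemma oplus_single [DecidableEq ι] (n : ι) (g : X n → ℝ≥0) (x : ∀ k, X k) :
    oplus (single n g) x = g (x n) := by
  rw [oplus, tsum_eq_single n (by intro k hk; simp [single, hk])]
  simp [single]

end Oplus

/-! ### Dominated functionals -/

section Functional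

variable {ι : Type*} {X : ι → Type*} [∀ n, MeasurableSpace (X n)] {ν : ∀ n, Measure (X n)}

lemma price_add {g : ∀ n, X n → ℝ≥0} (hg : ∀ n, Measurable (g n)) (g' : ∀ n, X n → ℝ≥0) :
    price ν (g + g') = price ν g + price ν g' := by
  unfold price
  rw [← ENNReal.tsum_add]
  refine tsum_congr fun n => ?_
  rw [← lintegral_add_left (by have := hg n; fun_prop)]
  simp

lemma price_smul (c : ℝ≥0) {g : ∀ n, X n → ℝ≥0} (hg : ∀ n, Measurable (g n)) :
    price ν (fun n y => c * g n y) = c * price ν g := by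
  unfold price
  rw [← ENNReal.tsum_mul_left]
  refine tsum_congr fun n => ?_
  rw [← lintegral_const_mul _ (by have := hg n; fun_prop)]
  simp

lemma price_single [DecidableEq ι] (n : ι) (g : X n → ℝ≥0) :
    price ν (single n g) = ∫⁻ y, g y ∂(ν n) := by
  rw [price, tsum_eq_single n (by intro k hk; simp [single, hk])]
  simp [single]

lemma isAdmissible_single [DecidableEq ι] {n : ι} {g : X n → ℝ≥0} (hg : Measurable g)
    (hfin : ∫⁻ y, g y ∂(ν n) < ∞) : IsAdmissible ν (single n g) := by
  refine ⟨fun k => ?_, by rwa [price_single]⟩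
  rcases eq_or_ne k n with rfl | hk
  · simpa [single] using hg
  · simp only [single, Pi.single_eq_of_ne hk]
    exact measurable_zero

/-- The domination property: `ψ k ≤ m + ∑ₙ ⟨gₙ, νₙ⟩` whenever `k ≤ m + ⊕g`. -/
def IsDominated (ψ : BSpace ν → ℝ) : Prop :=
  ∀ (k : BSpace ν) (m : ℝ) (g : ∀ n, X n → ℝ≥0), IsAdmissible ν g →
    (∀ x, ENNReal.ofReal (k.1 x - m) ≤ oplus g x) → ψ k ≤ m + (price ν g).toReal

/-- Since `b` is nonnegative, cutting a - m at 0 loses nothing; this removes extended-real sums from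
the domination property. -/
lemma coe_le_coe_add_iff {a m : ℝ} {b : ℝ≥0∞} :
    (a : EReal) ≤ (m : EReal) + (b : EReal) ↔ ENNReal.ofReal (a - m) ≤ b := by
  induction b with
  | top => simp
  | coe b =>
    rw [show ((b : ℝ≥0∞) : EReal) = ((b : ℝ) : EReal) from rfl, ← EReal.coe_add,
      EReal.coe_le_coe_iff, ENNReal.ofReal_le_iff_le_toReal ENNReal.coe_ne_top,
      ENNReal.coe_toReal, sub_le_iff_le_add']

lemma isDominated_of_ereal {φ : BSpace ν → ℝ}
    (hdom : ∀ (f : BSpace ν) (m : ℝ) (g : ∀ n, X n → ℝ≥0), IsAdmissible ν g →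
      (∀ x, ((f.1 x : ℝ) : EReal) ≤ (m : EReal) + ((oplus g x : ℝ≥0∞) : EReal)) →
      ((φ f : ℝ) : EReal) ≤ (m : EReal) + ((price ν g : ℝ≥0∞) : EReal)) :
    IsDominated φ := by
  intro k m g hg hk
  have h := hdom k m g hg fun x => coe_le_coe_add_iff.2 (hk x)
  rw [coe_le_coe_add_iff, ENNReal.ofReal_le_iff_le_toReal hg.2.ne] at h
  linarith

/-- A subgradient of a dominated function is dominated. -/
lemma isDominated_of_subgradient {φ : BSpace ν → ℝ} (hφ : IsDominated φ) {f : BSpace ν}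
    {ℓ : BSpace ν →ₗ[ℝ] ℝ} (hℓ : ∀ k, ℓ k ≤ φ (f + k) - φ f) : IsDominated ℓ := by
  intro k m g hg hk
  obtain ⟨-, _, ⟨gf, hgf, rfl⟩, hf⟩ := f.2
  -- Domination of φ at f + n•k costs the fixed price of a bound for |f| plus n times the claimed
  -- bound. As n grows, the fixed part is negligible.
  have key : ∀ n : ℕ, (n : ℝ) * (ℓ k - (m + (price ν g).toReal)) ≤
      (price ν gf).toReal - φ f := by
    intro n
    have h1 := hφ (f + (n : ℝ) • k) (n * m) (gf + fun i y => (n : ℝ≥0) * g i y)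
      (hgf.add (hg.smul n)) fun x => by
        rw [oplus_add, oplus_smul]
        calc ENNReal.ofReal (f.1 x + n * k.1 x - n * m)
            ≤ ENNReal.ofReal (|f.1 x| + n * (k.1 x - m)) :=
              ENNReal.ofReal_le_ofReal (by linarith [le_abs_self (f.1 x)])
          _ ≤ ENNReal.ofReal |f.1 x| + ENNReal.ofReal (n * (k.1 x - m)) := ENNReal.ofReal_add_le
          _ ≤ _ := by
            refine add_le_add (hf x) ?_
            rw [ENNReal.ofReal_mul n.cast_nonneg, ENNReal.ofReal_natCast, ENNReal.coe_natCast]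
            gcongr
            exact hk x
    rw [price_add hgf.1, price_smul _ hg.1, ENNReal.toReal_add hgf.2.ne
      (ENNReal.mul_ne_top ENNReal.coe_ne_top hg.2.ne), ENNReal.toReal_mul] at h1
    have h2 := hℓ ((n : ℝ) • k)
    rw [map_smul, smul_eq_mul] at h2
    simp only [ENNReal.coe_natCast, ENNReal.toReal_natCast] at h1
    linarith
  by_contra! hlt
  obtain ⟨n, hn⟩ := exists_nat_gt (((price ν gf).toReal - φ f) /
    (ℓ k - (m + (price ν g).toReal)))
  rw [div_lt_iff₀ (by linarith)] at hn
  exact absurd (key n) (not_le.2 hn)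

end Functional

/-! ### Integrating ⊕g under a coupling -/

section Coupling

variable {ι : Type*} [Countable ι] {X : ι → Type*} [∀ n, MeasurableSpace (X n)]
  {ν : ∀ n, Measure (X n)}

lemma lintegral_oplus {g : ∀ n, X n → ℝ≥0} (hg : ∀ n, Measurable (g n))
    {μ : Measure (∀ n, X n)} (hμ : μ ∈ Couplings ν) : ∫⁻ x, oplus g x ∂μ = price ν g := by
  unfold oplus price
  rw [lintegral_tsum]
  · refine tsum_congr fun n => ?_
    have := hg n
    rw [← hμ.2 n, lintegral_map (by fun_prop) (measurable_pi_apply n)]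
  · exact fun n => ((hg n).comp (measurable_pi_apply n)).coe_nnreal_ennreal.aemeasurable

lemma integral_toReal_oplus {g : ∀ n, X n → ℝ≥0} (hg : IsAdmissible ν g)
    {μ : Measure (∀ n, X n)} (hμ : μ ∈ Couplings ν) :
    ∫ x, (oplus g x).toReal ∂μ = (price ν g).toReal := by
  have hm : Measurable (oplus g) := Measurable.tsum fun n =>
    ((hg.1 n).comp (measurable_pi_apply n)).coe_nnreal_ennreal
  rw [integral_toReal hm.aemeasurable, lintegral_oplus hg.1 hμ]
  exact ae_lt_top hm (by rw [lintegral_oplus hg.1 hμ]; exact hg.2.ne)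

end Coupling

/-! ### Product compacts and stability of U(ν) -/

section Product

variable {ι : Type*} [Countable ι] {X : ι → Type*}
  [∀ n, TopologicalSpace (X n)] [∀ n, PolishSpace (X n)]
  [∀ n, MeasurableSpace (X n)] [∀ n, BorelSpace (X n)]

/-- Product compacts of almost full mass. -/
lemma exists_isCompact_family (ν : ∀ n, Measure (X n)) [∀ n, IsProbabilityMeasure (ν n)]
    {ε : ℝ≥0∞} (hε : ε ≠ 0) :
    ∃ K : ∀ n, Set (X n), (∀ n, IsCompact (K n)) ∧ ∑' n, ν n (K n)ᶜ < ε := by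
  obtain ⟨δ, hδ, hsum⟩ := ENNReal.exists_pos_sum_of_countable' hε ι
  have h : ∀ n, ∃ K : Set (X n), IsCompact K ∧ ν n Kᶜ ≤ δ n := fun n => by
    obtain ⟨K, hK, hKν⟩ := isTightMeasureSet_iff_exists_isCompact_measure_compl_le.1
      (isTightMeasureSet_singleton (μ := ν n)) (δ n) (hδ n)
    exact ⟨K, hK, hKν _ rfl⟩
  choose K hK hKν using h
  exact ⟨K, hK, (ENNReal.tsum_le_tsum hKν).trans_lt hsum⟩

variable {ν : ∀ n, Measure (X n)}

/-- `U(ν)` is stable under adding bounded nonnegative upper semicontinuous functions. -/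
lemma add_mem_uSet {h u : (∀ n, X n) → ℝ} (hh : h ∈ USet ν) (hu : UpperSemicontinuous u)
    (hu0 : ∀ x, 0 ≤ u x) {C : ℝ} (huC : ∀ x, u x ≤ C) : h + u ∈ USet ν := by
  obtain ⟨husc, ⟨hm, D, hD⟩, hm', G, hG, hhG⟩ := hh
  have husc' : UpperSemicontinuous (h + u) := husc.add hu
  refine ⟨husc', ⟨husc'.measurable.max measurable_const, D + C, fun x => ?_⟩,
    husc'.measurable.neg.max measurable_const, G, hG, fun x => ?_⟩
  · rw [abs_of_nonneg (le_max_right _ _)]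
    have h1 := (le_abs_self _).trans (hD x)
    have h2 := (le_max_left _ _).trans h1
    have h3 := (le_max_right _ _).trans h1
    have h4 := hu0 x
    have h5 := huC x
    exact max_le (show h x + u x ≤ D + C by linarith) (by linarith)
  · refine le_trans (ENNReal.ofReal_le_ofReal ?_) (hhG x)
    rw [abs_of_nonneg (le_max_right _ _), abs_of_nonneg (le_max_right _ _)]
    exact max_le_max (by rw [Pi.add_apply]; linarith [hu0 x]) le_rfl

end Product

/-! ### From dominated functionals to couplings -/

section Duality

variable {ι : Type*} [Countable ι] [Nonempty ι] {X : ι → Type*}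
  [∀ n, TopologicalSpace (X n)] [∀ n, PolishSpace (X n)]
  [∀ n, MeasurableSpace (X n)] [∀ n, BorelSpace (X n)]
  {ν : ∀ n, Measure (X n)} [∀ n, IsProbabilityMeasure (ν n)]

open BoundedContinuousFunction

/-- Bounded continuous functions as elements of `B(ν)`. -/
def ofBCF (ν : ∀ n, Measure (X n)) [∀ n, IsProbabilityMeasure (ν n)] :
    ((∀ n, X n) →ᵇ ℝ) →ₗ[ℝ] BSpace ν where
  toFun k := ⟨k, cbSet_subset_bSpace ν ⟨k.continuous, ‖k‖, k.norm_coe_le_norm⟩⟩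
  map_add' _ _ := rfl
  map_smul' _ _ := rfl

@[simp] lemma ofBCF_apply (k : (∀ n, X n) →ᵇ ℝ) (x : ∀ n, X n) : (ofBCF ν k).1 x = k x := rfl

/-- A dominated linear functional on `B(ν)` is given on bounded continuous functions by a measure
with marginals `νₙ`. -/
lemma exists_coupling {ℓ : BSpace ν →ₗ[ℝ] ℝ} (hℓ : IsDominated ℓ) :
    ∃ μ ∈ Couplings ν, ∀ k : (∀ n, X n) →ᵇ ℝ, ∫ x, k x ∂μ = ℓ (ofBCF ν k) := by
  classical
  have hzero : IsAdmissible ν (0 : ∀ n, X n → ℝ≥0) := ⟨fun _ => measurable_const, by simp [price]⟩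
  -- Domination with g = 0 gives ℓ k ≤ sup k, hence positivity and normalization.
  have hconst : ∀ (k : BSpace ν) (m : ℝ), (∀ x, k.1 x ≤ m) → ℓ k ≤ m := fun k m h => by
    have := hℓ k m 0 hzero fun x => by
      rw [ENNReal.ofReal_of_nonpos (sub_nonpos.2 (h x))]; exact zero_le
    simpa [price] using this
  have hone : ℓ (ofBCF ν (const _ 1)) = 1 := by
    refine le_antisymm (hconst _ _ fun x => le_rfl) ?_
    have := hconst (-ofBCF ν (const _ 1)) (-1) fun x => le_rfl
    rw [map_neg] at this
    linarith
  obtain ⟨μ, hμ, hint⟩ := exists_measure_of_tight (ℓ ∘ₗ ofBCF ν)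
    (fun k hk => by
      have := hconst (-ofBCF ν k) 0 fun x => neg_nonpos.2 (hk x)
      rw [map_neg] at this
      simpa using this) hone
    (fun ε hε => by
      obtain ⟨K, hK, hKε⟩ := exists_isCompact_family ν (ENNReal.ofReal_pos.2 hε).ne'
      refine ⟨Set.univ.pi K, isCompact_univ_pi hK, fun k hk1 hk0 => ?_⟩
      -- A point outside the product compact leaves some `K n`, so k ≤ ⊕g, at total price below ε.
      let g : ∀ n, X n → ℝ≥0 := fun n => (K n)ᶜ.indicator 1
      have hmeas : ∀ n, MeasurableSet (K n)ᶜ := fun n => (hK n).measurableSet.compl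
      have hcoe : ∀ n y, (g n y : ℝ≥0∞) = (K n)ᶜ.indicator 1 y := fun n y => by
        by_cases hy : y ∈ K n <;> simp [g, hy]
      have hprice : price ν g = ∑' n, ν n (K n)ᶜ := by
        simp only [price, hcoe]
        exact tsum_congr fun n => lintegral_indicator_one (hmeas n)
      have hadm : IsAdmissible ν g :=
        ⟨fun n => measurable_one.indicator (hmeas n), hprice ▸ hKε.trans ENNReal.ofReal_lt_top⟩
      have h1 := hℓ (ofBCF ν k) 0 g hadm fun x => by
        rw [ofBCF_apply, sub_zero]
        by_cases hx : ∀ n, x n ∈ K n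
        · rw [ENNReal.ofReal_of_nonpos (hk0 x fun n _ => hx n)]; exact zero_le
        · push Not at hx
          obtain ⟨n, hn⟩ := hx
          calc ENNReal.ofReal (k x) ≤ 1 := ENNReal.ofReal_le_one.2 (hk1 x)
            _ = g n (x n) := by simp [g, hn]
            _ ≤ oplus g x := ENNReal.le_tsum n
      rw [zero_add] at h1
      refine h1.trans ?_
      rw [hprice]
      exact ENNReal.toReal_le_of_le_ofReal hε.le hKε.le)
  refine ⟨μ, ⟨hμ, fun n => ?_⟩, hint⟩
  have : IsProbabilityMeasure (μ.map fun x : ∀ n, X n => x n) :=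
    Measure.isProbabilityMeasure_map (measurable_pi_apply n).aemeasurable
  -- One inequality suffices: applied to -k it gives the reverse.
  have hle : ∀ k : X n →ᵇ ℝ, ∫ y, k y ∂(μ.map fun x => x n) ≤ ∫ y, k y ∂(ν n) := by
    intro k
    rw [integral_map (measurable_pi_apply n).aemeasurable k.continuous.aestronglyMeasurable]
    refine (hint (k.compContinuous ⟨fun x => x n, continuous_apply n⟩)).trans_le ?_
    -- The shift by ‖k‖ makes `g` nonnegative and is undone by m = -‖k‖.
    let g : X n → ℝ≥0 := fun y => (k y + ‖k‖).toNNReal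
    have hg0 : ∀ y, 0 ≤ k y + ‖k‖ := fun y => by
      linarith [(abs_le.1 (k.norm_coe_le_norm y)).1]
    have hg : Measurable g := (k.continuous.measurable.add_const _).real_toNNReal
    have hgint : ∫⁻ y, g y ∂(ν n) = ENNReal.ofReal (∫ y, k y ∂(ν n) + ‖k‖) := by
      have h1 := ofReal_integral_eq_lintegral_ofReal (μ := ν n)
        ((k.integrable (ν n)).add (integrable_const ‖k‖)) (Eventually.of_forall hg0)
      simp only [Pi.add_apply] at h1
      rw [integral_add (k.integrable _) (integrable_const _), integral_const] at h1
      simp only [probReal_univ, one_smul] at h1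
      exact h1.symm
    have hI0 : 0 ≤ ∫ y, k y ∂(ν n) + ‖k‖ := by
      have h1 : 0 ≤ ∫ y, (k y + ‖k‖) ∂(ν n) := integral_nonneg hg0
      rw [integral_add (k.integrable _) (integrable_const _), integral_const] at h1
      simpa using h1
    have h1 := hℓ (ofBCF ν (k.compContinuous ⟨fun x => x n, continuous_apply n⟩)) (-‖k‖)
      (single n g) (isAdmissible_single hg (by rw [hgint]; exact ENNReal.ofReal_lt_top))
      fun x => by
        rw [oplus_single, sub_neg_eq_add]
        exact le_rfl
    rw [price_single, hgint, ENNReal.toReal_ofReal hI0] at h1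
    refine h1.trans (by linarith)
  refine ext_of_forall_integral_eq_of_IsFiniteMeasure fun k => le_antisymm (hle k) ?_
  have := hle (-k)
  simp only [BoundedContinuousFunction.coe_neg, Pi.neg_apply, integral_neg] at this
  linarith

/-- If `ℓ` is dominated and given on bounded continuous functions by `μ`, then `ℓ ≤ ⟨·, μ⟩` on
`U(ν)`. -/
lemma le_integral_of_mem_uSet {ℓ : BSpace ν →ₗ[ℝ] ℝ} (hℓ : IsDominated ℓ)
    {μ : Measure (∀ n, X n)} (hμ : μ ∈ Couplings ν)
    (hint : ∀ k : (∀ n, X n) →ᵇ ℝ, ∫ x, k x ∂μ = ℓ (ofBCF ν k))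
    {h : BSpace ν} (hh : h.1 ∈ USet ν) : ℓ h ≤ ∫ x, h.1 x ∂μ := by
  have := hμ.1
  obtain ⟨husc, ⟨-, C, hC⟩, -⟩ := hh
  have hC' : ∀ x, h.1 x ≤ C := fun x => (le_max_left _ _).trans ((le_abs_self _).trans (hC x))
  obtain ⟨k, hkc, hkl, hhk, hku, hlim⟩ :=
    exists_continuous_tendsto_of_upperSemicontinuous husc hC'
  let K : ℕ → (∀ n, X n) →ᵇ ℝ := fun j =>
    BoundedContinuousFunction.ofNormedAddCommGroup (k j) (hkc j) (j + max C 0) fun x => by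
      rw [Real.norm_eq_abs, abs_le]
      have h1 := hkl j x
      have h2 := hku j x
      have h3 : (0 : ℝ) ≤ j := j.cast_nonneg
      have h4 := le_max_right C 0
      constructor <;> linarith
  -- ℓ h ≤ ℓ k_j = ∫ k_j, and h ≤ k_j ≤ max C 0 supplies the dominating function.
  refine ge_of_tendsto' (tendsto_integral_of_dominated_convergence
    (F := fun j x => k j x) (fun x => |h.1 x| + max C 0) (fun j => (hkc j).aestronglyMeasurable)
    ((integrable_of_mem h.2 hμ).abs.add (integrable_const _))
    (fun j => Eventually.of_forall fun x => ?_) (Eventually.of_forall hlim)) fun j => ?_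
  · rw [Real.norm_eq_abs, abs_le]
    have h1 := hhk j x
    have h2 := hku j x
    have h3 := neg_abs_le (h.1 x)
    have h4 := le_max_right C 0
    constructor <;> linarith [abs_nonneg (h.1 x)]
  · have h0 : ℓ (h - ofBCF ν (K j)) ≤ 0 := by
      have := hℓ (h - ofBCF ν (K j)) 0 0 ⟨fun _ => measurable_const, by simp [price]⟩ fun x => by
        rw [ENNReal.ofReal_of_nonpos]
        · exact zero_le
        · rw [sub_zero]
          exact sub_nonpos.2 (hhk j x)
      simpa [price] using this
    rw [map_sub, ← hint] at h0
    exact sub_nonpos.1 h0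

/-- Elements of `U(ν) + G(ν)` are approximated from below by elements of `U(ν)`. -/
lemma exists_uSet_le {f : BSpace ν} {h : (∀ n, X n) → ℝ} (hh : h ∈ USet ν)
    {g : ∀ n, X n → ℝ≥0} (hg : IsAdmissible ν g)
    (hf : ∀ x, f.1 x = h x + (oplus g x).toReal) (hfin : ∀ x, oplus g x ≠ ∞)
    {μ : Measure (∀ n, X n)} (hμ : μ ∈ Couplings ν) {ε : ℝ} (hε : 0 < ε) :
    ∃ k : BSpace ν, k.1 ∈ USet ν ∧ k ≤ f ∧ ∫ x, f.1 x ∂μ ≤ ∫ x, k.1 x ∂μ + ε := by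
  classical
  have hε2 : ENNReal.ofReal (ε / 2) ≠ 0 := (ENNReal.ofReal_pos.2 (half_pos hε)).ne'
  -- Half of ε is shared among the coordinatewise approximations; the other half pays for keeping
  -- finitely many coordinates, which makes ⊕v bounded and upper semicontinuous.
  obtain ⟨δ, hδ, hδsum⟩ := ENNReal.exists_pos_sum_of_countable' hε2 ι
  have hgn : ∀ n, ∫⁻ y, g n y ∂(ν n) ≠ ∞ := ENNReal.ne_top_of_tsum_ne_top hg.2.ne
  have hex := fun n => exists_bounded_upperSemicontinuous_le (ν n) (hg.1 n) (hgn n) (hδ n).ne'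
  choose u N hug huN husc hui using hex
  have hlim := (ENNReal.summable (f := fun n => ∫⁻ y, g n y ∂(ν n))).hasSum
  obtain ⟨F, hF⟩ := ((Tendsto.add_const (ENNReal.ofReal (ε / 2)) hlim).eventually
    (eventually_gt_nhds (ENNReal.lt_add_right hg.2.ne hε2))).exists
  let v : ∀ n, X n → ℝ≥0 := fun n => if n ∈ F then u n else 0
  have hvm : ∀ n, Measurable (v n) := fun n => by
    by_cases hn : n ∈ F
    · simpa [v, hn] using (husc n).measurable
    · simp only [v, hn, if_false]; exact measurable_zero
  have hvo : ∀ x, oplus v x = ∑ n ∈ F, (u n (x n) : ℝ≥0∞) := fun x => by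
    rw [oplus, tsum_eq_sum (s := F) fun n hn => by simp [v, hn]]
    exact Finset.sum_congr rfl fun n hn => by simp [v, hn]
  have hvp : price ν v = ∑ n ∈ F, ∫⁻ y, u n y ∂(ν n) := by
    rw [price, tsum_eq_sum (s := F) fun n hn => by simp [v, hn]]
    exact Finset.sum_congr rfl fun n hn => by simp [v, hn]
  have hvg : ∀ x, oplus v x ≤ oplus g x := fun x => ENNReal.tsum_le_tsum fun n => by
    by_cases hn : n ∈ F
    · simpa [v, hn] using hug n (x n)
    · simp [v, hn]
  have hva : IsAdmissible ν v := by
    refine ⟨hvm, ?_⟩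
    rw [hvp]
    exact ENNReal.sum_lt_top.2 fun n _ => lt_of_le_of_lt
      (lintegral_mono fun y => ENNReal.coe_le_coe.2 (hug n y)) (hgn n).lt_top
  have hprice : price ν g ≤ price ν v + ENNReal.ofReal ε := by
    calc price ν g ≤ ∑ n ∈ F, ∫⁻ y, g n y ∂(ν n) + ENNReal.ofReal (ε / 2) := hF.le
      _ ≤ ∑ n ∈ F, (∫⁻ y, u n y ∂(ν n) + δ n) + ENNReal.ofReal (ε / 2) := by
        gcongr with n _; exact hui n
      _ ≤ price ν v + ENNReal.ofReal (ε / 2) + ENNReal.ofReal (ε / 2) := by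
        rw [Finset.sum_add_distrib, ← hvp]
        gcongr
        exact (ENNReal.sum_le_tsum F).trans hδsum.le
      _ = _ := by
        rw [add_assoc, ← ENNReal.ofReal_add (half_pos hε).le (half_pos hε).le, add_halves]
  have hvr : ∀ x, (oplus v x).toReal = ∑ n ∈ F, (u n (x n) : ℝ) := fun x => by
    rw [hvo, ENNReal.toReal_sum fun _ _ => ENNReal.coe_ne_top]
    rfl
  have hkU : h + (fun x => (oplus v x).toReal) ∈ USet ν := by
    refine add_mem_uSet hh ?_ (fun x => ENNReal.toReal_nonneg) (C := ∑ n ∈ F, (N n : ℝ)) ?_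
    · simp only [hvr]
      refine upperSemicontinuous_sum fun n _ => ?_
      exact (NNReal.continuous_coe.comp_upperSemicontinuous (husc n)
        NNReal.coe_mono).comp (continuous_apply n)
    · intro x
      rw [hvr]
      exact Finset.sum_le_sum fun n _ => by exact_mod_cast huN n (x n)
  have hhB : h ∈ BSpace ν := uSet_subset_bSpace ν hh
  refine ⟨⟨_, uSet_subset_bSpace ν hkU⟩, hkU, fun x => ?_, ?_⟩
  · change h x + (oplus v x).toReal ≤ f.1 x
    rw [hf]
    gcongr
    exacts [hfin x, hvg x]
  · have hint : ∀ {w : ∀ n, X n → ℝ≥0}, IsAdmissible ν w → ∀ k ∈ BSpace ν,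
        (∀ x, k x = h x + (oplus w x).toReal) →
        ∫ x, k x ∂μ = ∫ x, h x ∂μ + (price ν w).toReal := by
      intro w hw k hk hkw
      have h1 : (fun x => (oplus w x).toReal) = k - h := by
        ext x
        simp [hkw x]
      rw [← integral_toReal_oplus hw hμ, h1]
      rw [integral_sub' (integrable_of_mem hk hμ) (integrable_of_mem hhB hμ)]
      ring
    rw [hint hg _ f.2 hf, hint hva _ (uSet_subset_bSpace ν hkU) fun x => rfl]
    have h2 := ENNReal.toReal_mono
      (ENNReal.add_ne_top.2 ⟨hva.2.ne, ENNReal.ofReal_ne_top⟩) hprice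
    rw [ENNReal.toReal_add hva.2.ne ENNReal.ofReal_ne_top, ENNReal.toReal_ofReal hε.le] at h2
    linarith

end Duality

end MarginalDuality

/-! ### The duality theorem -/

theorem mainTheorem8 {ι : Type*} [Countable ι] [Nonempty ι] {X : ι → Type*}
    [∀ n, TopologicalSpace (X n)] [∀ n, PolishSpace (X n)]
    [∀ n, MeasurableSpace (X n)] [∀ n, BorelSpace (X n)]
    (ν : ∀ n, Measure (X n)) [∀ n, IsProbabilityMeasure (ν n)]
    (φ : MarginalDuality.BSpace ν → ℝ)
    (hmono : Monotone φ)
    (hconvex : ConvexOn ℝ Set.univ φ)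
    (hdom : ∀ (f : MarginalDuality.BSpace ν) (m : ℝ) (g : ∀ n, X n → ℝ≥0),
      MarginalDuality.IsAdmissible ν g →
      (∀ x, ((f.1 x : ℝ) : EReal) ≤ (m : EReal) + ((MarginalDuality.oplus g x : ℝ≥0∞) : EReal)) →
      ((φ f : ℝ) : EReal) ≤ (m : EReal) + ((MarginalDuality.price ν g : ℝ≥0∞) : EReal))
    (hconj : ∀ μ ∈ MarginalDuality.Couplings ν,
      MarginalDuality.conj φ (MarginalDuality.CbSet X) μ =
        MarginalDuality.conj φ (MarginalDuality.USet ν) μ)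
    (f : MarginalDuality.BSpace ν)
    (hf : ∃ h ∈ MarginalDuality.USet ν, ∃ G ∈ MarginalDuality.GSet ν,
      ∀ x, ((f.1 x : ℝ) : EReal) = ((h x : ℝ) : EReal) + ((G x : ℝ≥0∞) : EReal)) :
    IsGreatest
      ((fun μ : Measure (∀ n, X n) =>
          ((∫ x, f.1 x ∂μ : ℝ) : EReal) -
            MarginalDuality.conj φ (MarginalDuality.CbSet X) μ) ''
        MarginalDuality.Couplings ν)
      ((φ f : ℝ) : EReal) := by
  open MarginalDuality in
  obtain ⟨h, hh, _, ⟨g, hg, rfl⟩, hfhg⟩ := hf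
  have hfin : ∀ x, oplus g x ≠ ∞ := fun x hx => by
    have := hfhg x
    simp [hx] at this
  have hf : ∀ x, f.1 x = h x + (oplus g x).toReal := fun x => by
    have := hfhg x
    rw [← ENNReal.coe_toNNReal (hfin x)] at this
    exact EReal.coe_injective this
  have upper : ∀ μ ∈ Couplings ν,
      ((∫ x, f.1 x ∂μ : ℝ) : EReal) - conj φ (CbSet X) μ ≤ (φ f : ℝ) := by
    intro μ hμ
    have key : ((∫ x, f.1 x ∂μ - φ f : ℝ) : EReal) ≤ conj φ (CbSet X) μ := by
      -- The gap between `z` and ⟨f, μ⟩ - φ f is the error allowed in approximating `f` from U(ν).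
      refine EReal.ge_of_forall_gt_iff_ge.1 fun z hz => ?_
      obtain ⟨k, hkU, hkf, hk⟩ :=
        exists_uSet_le hh hg hf hfin hμ (sub_pos.2 (EReal.coe_lt_coe_iff.1 hz))
      rw [hconj μ hμ]
      refine le_trans (EReal.coe_le_coe_iff.2 ?_)
        (le_iSup₂ (f := fun (k : BSpace ν) (_ : k.1 ∈ USet ν) =>
          ((∫ x, k.1 x ∂μ - φ k : ℝ) : EReal)) k hkU)
      linarith [hmono hkf]
    refine EReal.sub_le_of_le_add ((le_of_eq ?_).trans (add_le_add_right key _))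
    rw [← EReal.coe_add, add_sub_cancel]
  obtain ⟨ℓ, hℓ⟩ := exists_subgradient hconvex f
  have hℓdom : IsDominated ℓ := isDominated_of_subgradient (isDominated_of_ereal hdom) hℓ
  obtain ⟨μ, hμ, hint⟩ := exists_coupling hℓdom
  refine ⟨⟨μ, hμ, le_antisymm (upper μ hμ) ?_⟩, by rintro _ ⟨μ, hμ, rfl⟩; exact upper μ hμ⟩
  -- Split f = h + ⊕g; on ⊕g, domination with m = 0 gives the price, which equals ⟨⊕g, μ⟩.
  have hℓf : ℓ f ≤ ∫ x, f.1 x ∂μ := by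
    let h' : BSpace ν := ⟨h, uSet_subset_bSpace ν hh⟩
    have h1 : ℓ h' ≤ ∫ x, h x ∂μ := le_integral_of_mem_uSet hℓdom hμ hint hh
    have h2 : (fun x => (oplus g x).toReal) = fun x => f.1 x - h x := by
      ext x
      simp [hf x]
    have h3 := hℓdom (f - h') 0 g hg fun x => by
      have : (f - h').1 x = (oplus g x).toReal := (congrFun h2 x).symm
      rw [this, sub_zero, ENNReal.ofReal_toReal (hfin x)]
    rw [← integral_toReal_oplus hg hμ, h2,
      integral_sub (integrable_of_mem f.2 hμ) (integrable_of_mem h'.2 hμ), map_sub] at h3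
    linarith
  -- For k in C_b, ⟨k, μ⟩ - φ k = ℓ k - φ k ≤ ℓ f - φ f by the subgradient inequality at k - f.
  have hle : conj φ (CbSet X) μ ≤ ((∫ x, f.1 x ∂μ - φ f : ℝ) : EReal) := by
    refine iSup₂_le fun k hk => EReal.coe_le_coe_iff.2 ?_
    obtain ⟨hkc, C, hC⟩ := hk
    have h1 : ∫ x, k.1 x ∂μ = ℓ k :=
      hint (BoundedContinuousFunction.ofNormedAddCommGroup k.1 hkc C hC)
    have h2 := hℓ (k - f)
    rw [map_sub, add_sub_cancel] at h2
    linarith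
  refine le_trans (le_of_eq ?_) (EReal.sub_le_sub le_rfl hle)
  rw [← EReal.coe_sub]
  congr 1
  ring
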